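/- All topological groups are assumed to be Hausdorff. A topological group $G$ is *$h$-complete* if for every continuous homomorphism $\varphi\colon G\to H$ into a topological group $H$ the image $\varphi(G)$ is closed in $H$; it is *hereditarily $h$-complete* if every closed subgroup of $G$ is $h$-complete. $G$ has a *quasi-invariant basis* if for every neighborhood $U$ of the identity there is a countable family $\mathcal V$ of neighborhoods of the identity such that for every $g\in G$ there is $V\in\mathcal V$ with $gVg^{-1}\subseteq U$. **Theorem.** Let $G$ be a hereditarily $h$-complete group admitting a quasi-invariant basis. Then $G$ is the projective limit of its metrizable quotients. That is, let $\mathcal N$ be the set of all normal subgroups $N$ of $G$ such that $G/N$, with the quotient topology, is metrizable. Then $N_1\cap N_2\in\mathcal N$ for all $N_1,N_2\in\mathcal N$ (so the quotients $G/N$, $N\in\mathcal N$, with the canonical projections $G/N\to G/M$ for $N\subseteq M$, form a projective system), and the canonical map $$G\longrightarrow \varprojlim_{N\in\mathcal N} G/N=\Big\{(x_N)_N\in\prod_{N\in\mathcal N}G/N : x_N\mapsto x_M \text{ under } G/N\to G/M \text{ whenever } N\subseteq M\Big\},\qquad g\mapsto (gN)_{N\in\mathcal N},$$ is an isomorphism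 of topological groups, where the limit carries the subspace topology of the product topology. -/

import Mathlib

open Topology

universe u

/-- A topological group `G` is `h`-complete if the image of every continuous homomorphism from `G`
into a Hausdorff topological group `H` is closed in `H`. Letting `H` range over the universe of `G`
is no restriction: one may replace `H` by the closure of the image, a Hausdorff space with a dense
subset of cardinality at most that of `G`, hence of cardinality at most `2 ^ 2 ^ #G`. -/
def IsHComplete (G : Type u) [Group G] [TopologicalSpace G] : Prop :=
  ∀ (H : Type u) [Group H] [TopologicalSpace H] [IsTopologicalGroup H] [T2Space H]
    (φ : G →* H), Continuous φ → IsClosed (Set.range φ)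

/-- `G` is hereditarily `h`-complete if every closed subgroup of `G` (with the subspace topology)
is `h`-complete. -/
def IsHereditarilyHComplete (G : Type u) [Group G] [TopologicalSpace G] : Prop :=
  ∀ S : Subgroup G, IsClosed (S : Set G) → IsHComplete S

/-- `G` has a quasi-invariant basis if for every neighbourhood `U` of the identity there is a
countable family `𝒱` of neighbourhoods of the identity such that every `g : G` admits `V ∈ 𝒱` with
`g V g⁻¹ ⊆ U`. -/
def HasQuasiInvariantBasis (G : Type u) [Group G] [TopologicalSpace G] : Prop :=
  ∀ U ∈ 𝓝 (1 : G), ∃ 𝒱 : Set (Set G), 𝒱.Countable ∧ (∀ V ∈ 𝒱, V ∈ 𝓝 (1 : G)) ∧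
    ∀ g : G, ∃ V ∈ 𝒱, (fun x => g * x * g⁻¹) '' V ⊆ U

/-- The kernels of the metrizable quotients of `G`: the normal subgroups `N` for which `G ⧸ N`,
with the quotient topology, is metrizable (such an `N` is automatically closed). -/
def MetrizableKernel (G : Type u) [Group G] [TopologicalSpace G] : Type u :=
  {N : Subgroup G // N.Normal ∧ TopologicalSpace.MetrizableSpace (G ⧸ N)}

namespace MetrizableKernel

variable {G : Type u} [Group G] [TopologicalSpace G]

instance normal (N : MetrizableKernel G) : N.1.Normal := N.2.1

/-- For `N ≤ M`, the canonical projection `G ⧸ N → G ⧸ M`, `gN ↦ gM`. -/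
def transition (N M : MetrizableKernel G) (h : N.1 ≤ M.1) : G ⧸ N.1 →* G ⧸ M.1 :=
  QuotientGroup.map N.1 M.1 (MonoidHom.id G) h

end MetrizableKernel

/-- The projective limit of the metrizable quotients of `G`: the subgroup of the product of all
metrizable quotients formed by the families compatible with the canonical projections; it carries
the subspace topology of the product topology. -/
def metrizableLimit (G : Type u) [Group G] [TopologicalSpace G] :
    Subgroup ((N : MetrizableKernel G) → G ⧸ N.1) where
  carrier := {x | ∀ (N M : MetrizableKernel G) (h : N.1 ≤ M.1),
    MetrizableKernel.transition N M h (x N) = x M}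
  one_mem' := fun N M h => map_one (MetrizableKernel.transition N M h)
  mul_mem' := fun {x y} hx hy N M h => by
    rw [Pi.mul_apply, Pi.mul_apply, map_mul, hx N M h, hy N M h]
  inv_mem' := fun {x} hx N M h => by
    rw [Pi.inv_apply, Pi.inv_apply, map_inv, hx N M h]

open Filter Set Pointwise Uniformity

/-! The heart is an open mapping theorem, `IsHereditarilyHComplete.isOpenMap`, for homomorphisms
onto first countable Hausdorff groups. Quasi-invariance supplies enough continuous homomorphisms `g`
into such groups to induce the topology of `G`. Openness turns their kernels into metrizable kernels
and closes these under intersection, so the image of `G` in the limit is dense; `h`-completeness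
makes it closed, and single coordinates detect the neighbourhoods of `1`.

Openness of `f` is tested along a sequence tending to `1`. Lifts of its terms generate a separable
closed subgroup, `h`-complete by heredity, whose image under `(f, g)` is second countable and
`h`-complete. There the classical open mapping argument (Pettis, Lusin–Souslin) applies, because
first countable Hausdorff `h`-complete groups are completely metrizable. -/

theorem IsHComplete.of_surjective {G H : Type u} [Group G] [TopologicalSpace G] [Group H]
    [TopologicalSpace H] (hG : IsHComplete G) (f : G →* H) (hf : Continuous f)
    (hs : Function.Surjective f) : IsHComplete H := by
  intro K _ _ _ _ φ hφ
  have := hG K (φ.comp f) (hφ.comp hf)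
  rwa [MonoidHom.coe_comp, hs.range_comp] at this

/-! ### Completeness of `h`-complete groups. -/

section TwoSidedCauchy

variable {G : Type u} [Group G] [TopologicalSpace G]

/-- A sequence in a topological group is two-sided Cauchy if it is Cauchy for both the left and the
right uniformity. -/
structure IsTwoSidedCauchy (x : ℕ → G) : Prop where
  right : Tendsto (fun p : ℕ × ℕ => x p.1 * (x p.2)⁻¹) (atTop ×ˢ atTop) (𝓝 1)
  left : Tendsto (fun p : ℕ × ℕ => (x p.1)⁻¹ * x p.2) (atTop ×ˢ atTop) (𝓝 1)

namespace IsTwoSidedCauchy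

variable {x y : ℕ → G}

theorem const (g : G) : IsTwoSidedCauchy fun _ => g where
  right := by simpa using tendsto_const_nhds
  left := by simpa using tendsto_const_nhds

theorem inv (hx : IsTwoSidedCauchy x) : IsTwoSidedCauchy x⁻¹ where
  right := by simpa using hx.left
  left := by simpa using hx.right

variable [IsTopologicalGroup G]

/-- For large `n`, conjugation by `x n` is conjugation by a fixed `x N` followed by conjugation by
`x n * (x N)⁻¹`, which is close to `1`. This uniformity makes two-sided Cauchy sequences a group and
gives the conjugation axiom of its filter basis. -/
theorem tendsto_conj (hx : IsTwoSidedCauchy x) :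
    Tendsto (fun p : ℕ × G => x p.1 * p.2 * (x p.1)⁻¹) (atTop ×ˢ 𝓝 1) (𝓝 1) := by
  have hc : Tendsto (fun p : G × G => p.1 * p.2 * p.1⁻¹) (𝓝 1 ×ˢ 𝓝 1) (𝓝 1) := by
    have : Continuous fun p : G × G => p.1 * p.2 * p.1⁻¹ := by fun_prop
    simpa [nhds_prod_eq] using this.tendsto (1, 1)
  intro U hU
  obtain ⟨W, hW, hWU⟩ := Filter.mem_prod_same_iff.1 (hc hU)
  have h1 := hx.right hW
  obtain ⟨p, hp, q, hq, hpq⟩ := Filter.mem_prod_iff.1 h1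
  obtain ⟨N, hN⟩ := Filter.nonempty_of_mem (inter_mem hq hp)
  have h2 : Tendsto (fun v => x N * v * (x N)⁻¹) (𝓝 1) (𝓝 1) := by
    have : Continuous fun v => x N * v * (x N)⁻¹ := by fun_prop
    simpa using this.tendsto 1
  refine Filter.mem_prod_iff.2 ⟨p, hp, _, h2 hW, ?_⟩
  rintro ⟨n, v⟩ ⟨hn, hv⟩
  have := hWU (show (x n * (x N)⁻¹, x N * v * (x N)⁻¹) ∈ W ×ˢ W from
    ⟨hpq (show (n, N) ∈ p ×ˢ q from ⟨hn, hN.1⟩), hv⟩)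
  simpa [mul_assoc] using this

theorem mul (hx : IsTwoSidedCauchy x) (hy : IsTwoSidedCauchy y) : IsTwoSidedCauchy (x * y) where
  right := by
    have h1 := (hx.tendsto_conj.comp (tendsto_fst.prodMk hy.right)).mul hx.right
    simpa [Function.comp_def, mul_assoc] using h1
  left := by
    have h1 := (hy.inv.tendsto_conj.comp (tendsto_fst.prodMk hx.left)).mul hy.left
    simpa [Function.comp_def, mul_assoc] using h1

end IsTwoSidedCauchy

variable [IsTopologicalGroup G]

variable (G) in
/-- The group of two-sided Cauchy sequences. -/
def twoSidedCauchySeq : Subgroup (ℕ → G) where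
  carrier := {x | IsTwoSidedCauchy x}
  mul_mem' := IsTwoSidedCauchy.mul
  one_mem' := IsTwoSidedCauchy.const 1
  inv_mem' := IsTwoSidedCauchy.inv

variable (G) in
/-- The sets of two-sided Cauchy sequences that are eventually in a given neighbourhood of `1`. -/
@[reducible] def twoSidedCauchySeqBasis : GroupFilterBasis (twoSidedCauchySeq G) where
  sets := (fun U : Set G => {x | ∀ᶠ n in atTop, x.1 n ∈ U}) '' (𝓝 1).sets
  nonempty := ⟨_, univ, univ_mem, rfl⟩
  inter_sets := by
    rintro _ _ ⟨U, hU, rfl⟩ ⟨V, hV, rfl⟩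
    exact ⟨_, ⟨U ∩ V, inter_mem hU hV, rfl⟩, fun x hx => eventually_and.1 hx⟩
  one' := by
    rintro _ ⟨U, hU, rfl⟩
    exact Eventually.of_forall fun n => mem_of_mem_nhds hU
  mul' := by
    rintro _ ⟨U, hU, rfl⟩
    obtain ⟨V, hVo, hV1, hV⟩ := exists_open_nhds_one_mul_subset hU
    refine ⟨_, ⟨V, hVo.mem_nhds hV1, rfl⟩, ?_⟩
    rintro _ ⟨x, hx, y, hy, rfl⟩
    exact hx.mp (hy.mono fun n h1 h2 => hV (mul_mem_mul h2 h1))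
  inv' := by
    rintro _ ⟨U, hU, rfl⟩
    exact ⟨_, ⟨U⁻¹, inv_mem_nhds_one G hU, rfl⟩, fun x hx => hx⟩
  conj' := by
    rintro x _ ⟨U, hU, rfl⟩
    have hx : IsTwoSidedCauchy x.1 := x.2
    obtain ⟨p, hp, V, hV, hpV⟩ := Filter.mem_prod_iff.1 (hx.tendsto_conj hU)
    refine ⟨_, ⟨V, hV, rfl⟩, fun y (hy : ∀ᶠ n in atTop, y.1 n ∈ V) => ?_⟩
    change ∀ᶠ n in atTop, x.1 n * y.1 n * (x.1 n)⁻¹ ∈ U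
    filter_upwards [hy, hp] with n h1 h2
    exact hpV (show (n, y.1 n) ∈ p ×ˢ V from ⟨h2, h1⟩)

/-- In an `h`-complete group, two-sided Cauchy sequences converge. -/
theorem IsHComplete.exists_tendsto (hG : IsHComplete G) {x : ℕ → G} (hx : IsTwoSidedCauchy x) :
    ∃ g, Tendsto x atTop (𝓝 g) := by
  let B := twoSidedCauchySeqBasis G
  let := B.topology
  have := B.isTopologicalGroup
  let c : G →* twoSidedCauchySeq G :=
    { toFun := fun g => ⟨fun _ => g, IsTwoSidedCauchy.const g⟩
      map_one' := rfl
      map_mul' := fun _ _ => rfl }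
  have hc : Continuous c := by
    refine continuous_of_continuousAt_one c ?_
    rw [ContinuousAt, map_one, B.nhds_one_hasBasis.tendsto_right_iff]
    rintro _ ⟨U, hU, rfl⟩
    filter_upwards [hU] with g hg
    exact Eventually.of_forall fun _ => hg
  let q : twoSidedCauchySeq G →* SeparationQuotient (twoSidedCauchySeq G) :=
    { toFun := SeparationQuotient.mk
      map_one' := rfl
      map_mul' := fun _ _ => rfl }
  have hq : Continuous q := SeparationQuotient.continuous_mk
  have hcl := hG _ (q.comp c) (hq.comp hc)
  let X : twoSidedCauchySeq G := ⟨x, hx⟩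
  have hX : q X ∈ Set.range (q.comp c) := by
    rw [← hcl.closure_eq]
    -- The constant sequences at late terms of `x` approximate `x` itself.
    have : X ∈ closure (Set.range c) := by
      rw [mem_closure_iff_nhds_basis (B.nhds_hasBasis X)]
      rintro _ ⟨U, hU, rfl⟩
      obtain ⟨p, hp, r, hr, hpr⟩ := Filter.mem_prod_iff.1 (hx.left hU)
      obtain ⟨N, hN⟩ := Filter.nonempty_of_mem hr
      refine ⟨c (x N), ⟨_, rfl⟩, X⁻¹ * c (x N), ?_, by simp⟩
      change ∀ᶠ n in atTop, (x n)⁻¹ * x N ∈ U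
      filter_upwards [hp] with n hn
      exact hpr (show (n, N) ∈ p ×ˢ r from ⟨hn, hN⟩)
    have h2 := image_closure_subset_closure_image hq (mem_image_of_mem q this)
    rwa [← Set.range_comp] at h2
  obtain ⟨g, hg⟩ := hX
  refine ⟨g, ?_⟩
  have hi : Inseparable (c g) X := SeparationQuotient.mk_eq_mk.1 hg
  have h1 : Tendsto (fun n => g⁻¹ * x n) atTop (𝓝 1) := by
    intro U hU
    have : (c g) • {y : twoSidedCauchySeq G | ∀ᶠ n in atTop, y.1 n ∈ U} ∈ 𝓝 X := by
      rw [← hi.nhds_eq]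
      exact (B.nhds_hasBasis (c g)).mem_of_mem ⟨U, hU, rfl⟩
    obtain ⟨y, hy, hyX⟩ := mem_of_mem_nhds this
    have hyX : (c g) * y = X := hyX
    have hy' : y = (c g)⁻¹ * X := by rw [← hyX, inv_mul_cancel_left]
    rw [hy'] at hy
    exact hy
  simpa using h1.const_mul g

end TwoSidedCauchy

/-- The two-sided uniformity is countably generated, and its Cauchy sequences are exactly the
two-sided Cauchy ones. -/
theorem IsHComplete.isCompletelyMetrizableSpace {G : Type u} [Group G] [TopologicalSpace G]
    [IsTopologicalGroup G] [T2Space G] [FirstCountableTopology G] (hG : IsHComplete G) :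
    TopologicalSpace.IsCompletelyMetrizableSpace G := by
  let r := IsTopologicalGroup.rightUniformSpace G
  let l := IsTopologicalGroup.leftUniformSpace G
  have hr : 𝓤[r] = comap (fun p : G × G => p.2 * p.1⁻¹) (𝓝 1) := rfl
  have hl : 𝓤[l] = comap (fun p : G × G => p.1⁻¹ * p.2) (𝓝 1) := rfl
  let u : UniformSpace G := (r ⊓ l).replaceTopology 
    ((inf_idem _).symm.trans (UniformSpace.toTopologicalSpace_inf (u := r) (v := l)).symm)
  have hu : 𝓤[u] = 𝓤[r] ⊓ 𝓤[l] := inf_uniformity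
  have : (𝓤[u]).IsCountablyGenerated := by
    rw [hu, hr, hl]; infer_instance
  have : @CompleteSpace G u := by
    refine @UniformSpace.complete_of_cauchySeq_tendsto G u _ fun x hx => ?_
    have h := cauchySeq_iff_tendsto.1 hx
    rw [hu, hr, hl, tendsto_inf, tendsto_comap_iff, tendsto_comap_iff,
      ← prod_atTop_atTop_eq] at h
    refine hG.exists_tendsto ⟨?_, h.2⟩
    exact h.1.comp tendsto_prod_swap
  exact @TopologicalSpace.IsCompletelyMetrizableSpace.of_completeSpace_metrizable G u _ _ _

/-! ### Open mapping theorems for second countable groups. -/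

theorem secondCountableTopology_of_firstCountable {G : Type*} [Group G] [TopologicalSpace G]
    [IsTopologicalGroup G] [FirstCountableTopology G] [TopologicalSpace.SeparableSpace G] :
    SecondCountableTopology G := by
  let := IsTopologicalGroup.rightUniformSpace G
  have : (uniformity G).IsCountablyGenerated := comap.isCountablyGenerated _ _
  exact UniformSpace.secondCountable_of_separable G

/-- **Pettis' lemma**: if `s` is a nonmeagre set with the Baire property in a topological group,
then `s * s⁻¹` is a neighbourhood of `1`. -/
theorem BaireMeasurableSet.mul_inv_mem_nhds_one {G : Type*} [Group G] [TopologicalSpace G]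
    [IsTopologicalGroup G] [BaireSpace G] {s : Set G} (hs : BaireMeasurableSet s)
    (hm : ¬ IsMeagre s) : s * s⁻¹ ∈ 𝓝 1 := by
  obtain ⟨O, hO, hsO⟩ := hs.residualEq_isOpen
  obtain ⟨o, ho⟩ : O.Nonempty := by
    by_contra hne
    rw [not_nonempty_iff_eq_empty.1 hne, eventuallyEq_empty] at hsO
    exact hm hsO
  have hy : ∀ᶠ y in 𝓝 (1 : G), y⁻¹ * o ∈ O := by
    have : Continuous fun y : G => y⁻¹ * o := by fun_prop
    exact this.continuousAt.eventually_mem (hO.mem_nhds (by simpa using ho))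
  filter_upwards [hy] with y hy
  -- If `y ∉ s * s⁻¹`, then `s` and `y s` are disjoint, so the nonempty open set `O ∩ y O` is
  -- meagre.
  by_contra hcon
  have hsO' : (fun z => y⁻¹ * z) ⁻¹' s =ᵇ (fun z => y⁻¹ * z) ⁻¹' O :=
    (tendsto_residual_of_isOpenMap (continuous_const_mul y⁻¹)
      (isOpenMap_mul_left y⁻¹)).eventually hsO
  have hemp : s ∩ (fun z => y⁻¹ * z) ⁻¹' s = ∅ := by
    refine eq_empty_of_forall_notMem fun z hz => hcon ?_
    exact ⟨z, hz.1, (y⁻¹ * z)⁻¹, inv_mem_inv.2 hz.2, by simp⟩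
  have h := (hsO.inter hsO').symm
  rw [hemp, eventuallyEq_empty] at h
  exact not_isMeagre_of_isOpen (hO.inter (hO.preimage (continuous_const_mul y⁻¹)))
    ⟨o, ho, hy⟩ h

/-- A continuous homomorphism from a separable group onto a Baire group maps neighbourhoods of `1`
to nonmeagre sets. -/
theorem MonoidHom.not_isMeagre_image {G H : Type*} [Group G] [TopologicalSpace G]
    [IsTopologicalGroup G] [TopologicalSpace.SeparableSpace G] [Group H] [TopologicalSpace H]
    [IsTopologicalGroup H] [BaireSpace H] (f : G →* H) (hs : Function.Surjective f) {U : Set G}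
    (hU : U ∈ 𝓝 1) : ¬ IsMeagre (f '' U) := by
  intro hm
  obtain ⟨D, hDc, hD⟩ := TopologicalSpace.exists_countable_dense G
  -- Countably many translates of `f '' U` cover `H`.
  have hcov : (univ : Set H) ⊆ ⋃ d ∈ D, (fun z => (f d)⁻¹ * z) ⁻¹' (f '' U) := by
    intro y _
    obtain ⟨x, rfl⟩ := hs y
    have hx : ∀ᶠ d in 𝓝 x, d⁻¹ * x ∈ U := by
      have : Continuous fun d : G => d⁻¹ * x := by fun_prop
      exact this.continuousAt.eventually_mem (by simpa using hU)
    obtain ⟨d, hdU, hdD⟩ := hD.inter_nhds_nonempty hx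
    exact mem_biUnion hdU ⟨d⁻¹ * x, hdD, by simp⟩
  refine not_isMeagre_of_isOpen isOpen_univ univ_nonempty (IsMeagre.mono hcov ?_)
  exact isMeagre_biUnion hDc fun d _ =>
    hm.preimage_of_isOpenMap (continuous_const_mul _) (isOpenMap_mul_left _)

theorem MonoidHom.isOpenMap_of_image_mem_nhds_one {G H : Type*} [Group G] [TopologicalSpace G]
    [IsTopologicalGroup G] [Group H] [TopologicalSpace H] [IsTopologicalGroup H] (f : G →* H)
    (h : ∀ U ∈ 𝓝 (1 : G), f '' U ∈ 𝓝 (1 : H)) : IsOpenMap f := by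
  refine isOpenMap_iff_nhds_le.2 fun x => ?_
  rw [← map_mul_left_nhds_one x, ← map_mul_left_nhds_one (f x), Filter.map_map]
  have : f ∘ (fun y => x * y) = (fun y => f x * y) ∘ f := by ext; simp
  rw [this, ← Filter.map_map]
  exact map_mono (Filter.le_map h)

/-- The open mapping theorem for injective homomorphisms of Polish groups. -/
theorem MonoidHom.isOpenMap_of_polishSpace_of_injective {G H : Type*} [Group G]
    [TopologicalSpace G] [IsTopologicalGroup G] [PolishSpace G] [Group H] [TopologicalSpace H]
    [IsTopologicalGroup H] [T2Space H] [SecondCountableTopology H] [BaireSpace H] (f : G →* H)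
    (hf : Continuous f) (hi : Function.Injective f) (hs : Function.Surjective f) :
    IsOpenMap f := by
  refine f.isOpenMap_of_image_mem_nhds_one fun U hU => ?_
  obtain ⟨V, hV, hVU⟩ := exists_nhds_split_inv hU
  obtain ⟨W, hWV, hWo, hW1⟩ := mem_nhds_iff.1 hV
  borelize G H
  -- Lusin–Souslin: injectivity makes the image of an open set Borel, hence Baire measurable.
  have hmeas : MeasurableSet (f '' W) :=
    hWo.measurableSet.image_of_continuousOn_injOn hf.continuousOn hi.injOn
  refine mem_of_superset (hmeas.baireMeasurableSet.mul_inv_mem_nhds_one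
    (f.not_isMeagre_image hs (hWo.mem_nhds hW1))) ?_
  rintro _ ⟨_, ⟨a, ha, rfl⟩, b, hb, rfl⟩
  obtain ⟨c, hc, hcb⟩ := hb
  refine ⟨a / c, hVU a (hWV ha) c (hWV hc), ?_⟩
  rw [map_div, div_eq_mul_inv, hcb, inv_inv]

/-- The open mapping theorem for second countable `h`-complete groups. -/
theorem IsHComplete.isOpenMap_of_secondCountable {G H : Type u} [Group G] [TopologicalSpace G]
    [IsTopologicalGroup G] [SecondCountableTopology G] [Group H] [TopologicalSpace H]
    [IsTopologicalGroup H] [T2Space H] [SecondCountableTopology H] (hG : IsHComplete G)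
    (f : G →* H) (hf : Continuous f) (hs : Function.Surjective f) : IsOpenMap f := by
  have hH := (hG.of_surjective f hf hs).isCompletelyMetrizableSpace
  have hk : IsClosed (f.ker : Set G) := isClosed_singleton.preimage hf
  have hQ : IsHComplete (G ⧸ f.ker) := hG.of_surjective (QuotientGroup.mk' f.ker)
    QuotientGroup.continuous_mk (QuotientGroup.mk'_surjective _)
  have : T3Space (G ⧸ f.ker) := inferInstance
  have := hQ.isCompletelyMetrizableSpace
  have : PolishSpace (G ⧸ f.ker) := {}
  have hc : Continuous (QuotientGroup.kerLift f) := continuous_quot_lift _ hf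
  have hop := (QuotientGroup.kerLift f).isOpenMap_of_polishSpace_of_injective hc
    (QuotientGroup.kerLift_injective f) fun y => by
      obtain ⟨x, rfl⟩ := hs y
      exact ⟨x, rfl⟩
  exact hop.comp (QuotientGroup.isOpenMap_coe (N := f.ker))

/-! ### Homomorphisms into first countable groups from a quasi-invariant basis. -/

theorem Set.Countable.exists_closed_superset {α : Type*} (op : α → α → Set α)
    (hop : ∀ a b, (op a b).Countable) {s : Set α} (hs : s.Countable) :
    ∃ t, s ⊆ t ∧ t.Countable ∧ ∀ a ∈ t, ∀ b ∈ t, op a b ⊆ t := by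
  let F : Set α → Set α := fun t => t ∪ ⋃ a ∈ t, ⋃ b ∈ t, op a b
  have hmono : Monotone fun n => F^[n] s := monotone_nat_of_le_succ fun n => by
    rw [Function.iterate_succ_apply']
    exact subset_union_left
  refine ⟨⋃ n, F^[n] s, subset_iUnion (fun n => F^[n] s) 0, countable_iUnion fun n => ?_, ?_⟩
  · induction n with
    | zero => exact hs
    | succ n ih =>
      rw [Function.iterate_succ_apply']
      exact ih.union (ih.biUnion fun a _ => ih.biUnion fun b _ => hop a b)
  · intro a ha b hb
    obtain ⟨m, hm⟩ := mem_iUnion.1 ha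
    obtain ⟨n, hn⟩ := mem_iUnion.1 hb
    refine Subset.trans ?_ (subset_iUnion (fun n => F^[n] s) (max m n + 1))
    simp only [Function.iterate_succ_apply']
    refine Subset.trans ?_ subset_union_right
    exact subset_biUnion_of_mem (u := fun a => ⋃ b ∈ F^[max m n] s, op a b)
      (hmono (le_max_left m n) hm) |> Subset.trans
      (subset_biUnion_of_mem (u := fun b => op a b) (hmono (le_max_right m n) hn))

/-- In a group with a quasi-invariant basis, every neighbourhood of `1` belongs to a countable group
filter basis consisting of neighbourhoods of `1`. -/
theorem HasQuasiInvariantBasis.exists_groupFilterBasis {G : Type u} [Group G] [TopologicalSpace G]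
    [IsTopologicalGroup G] (hqi : HasQuasiInvariantBasis G) {U : Set G} (hU : U ∈ 𝓝 1) :
    ∃ B : GroupFilterBasis G, B.sets.Countable ∧ U ∈ B.sets ∧ ∀ V ∈ B.sets, V ∈ 𝓝 1 := by
  have hsplit : ∀ A : {A : Set G // A ∈ 𝓝 1}, ∃ V : {A : Set G // A ∈ 𝓝 1},
      V.1 * V.1 ⊆ A.1 ∧ V.1 ⊆ (fun x => x⁻¹) ⁻¹' A.1 := by
    intro A
    obtain ⟨V, hVo, hV1, hV⟩ := exists_open_nhds_one_mul_subset A.2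
    refine ⟨⟨V ∩ A.1⁻¹, inter_mem (hVo.mem_nhds hV1) (inv_mem_nhds_one G A.2)⟩, ?_, ?_⟩
    · exact (mul_subset_mul inter_subset_left inter_subset_left).trans hV
    · exact inter_subset_right
  choose S hSmul hSinv using hsplit
  choose 𝒱 hVc hVn hVconj using hqi
  -- Closing `{U}` under intersection, halving and the families `𝒱` gives all the basis axioms;
  -- quasi-invariance keeps the conjugation step countable.
  obtain ⟨T, hUT, hTc, hT⟩ := Set.Countable.exists_closed_superset
    (fun A B : {A : Set G // A ∈ 𝓝 1} =>
      {⟨A.1 ∩ B.1, inter_mem A.2 B.2⟩, S A} ∪ Subtype.val ⁻¹' 𝒱 A.1 A.2)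
    (fun A B => ((countable_singleton _).insert _).union
      ((hVc A.1 A.2).preimage Subtype.val_injective))
    (countable_singleton ⟨U, hU⟩)
  refine ⟨{ sets := Subtype.val '' T
            nonempty := ⟨U, _, hUT rfl, rfl⟩
            inter_sets := ?_
            one' := ?_
            mul' := ?_
            inv' := ?_
            conj' := ?_ }, hTc.image _, ⟨_, hUT rfl, rfl⟩, ?_⟩
  · rintro _ _ ⟨A, hA, rfl⟩ ⟨B, hB, rfl⟩
    exact ⟨_, ⟨_, hT A hA B hB (Or.inl (Or.inl rfl)), rfl⟩, Subset.rfl⟩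
  · rintro _ ⟨A, hA, rfl⟩
    exact mem_of_mem_nhds A.2
  · rintro _ ⟨A, hA, rfl⟩
    exact ⟨_, ⟨S A, hT A hA A hA (Or.inl (Or.inr rfl)), rfl⟩, hSmul A⟩
  · rintro _ ⟨A, hA, rfl⟩
    exact ⟨_, ⟨S A, hT A hA A hA (Or.inl (Or.inr rfl)), rfl⟩, hSinv A⟩
  · rintro g _ ⟨A, hA, rfl⟩
    obtain ⟨V, hV, hgV⟩ := hVconj A.1 A.2 g
    exact ⟨V, ⟨⟨V, hVn A.1 A.2 V hV⟩, hT A hA A hA (Or.inr hV), rfl⟩, image_subset_iff.1 hgV⟩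
  · rintro _ ⟨A, hA, rfl⟩
    exact A.2

/-- A countable group filter basis is induced by a homomorphism into a first countable Hausdorff
group. -/
theorem GroupFilterBasis.exists_monoidHom {G : Type u} [Group G] (B : GroupFilterBasis G)
    (hB : B.sets.Countable) :
    ∃ (M : Type u) (_ : Group M) (_ : TopologicalSpace M) (_ : IsTopologicalGroup M)
      (_ : T2Space M) (_ : FirstCountableTopology M) (g : G →* M),
      comap g (𝓝 1) = B.toFilterBasis.filter := by
  let := B.topology
  have := B.isTopologicalGroup
  have : (𝓝 (1 : G)).IsCountablyGenerated :=
    HasCountableBasis.isCountablyGenerated ⟨B.nhds_one_hasBasis, hB⟩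
  refine ⟨SeparationQuotient G, inferInstance, inferInstance, inferInstance, inferInstance, ⟨?_⟩,
    { toFun := SeparationQuotient.mk
      map_one' := rfl
      map_mul' := fun _ _ => rfl }, ?_⟩
  · intro y
    obtain ⟨x, rfl⟩ := SeparationQuotient.surjective_mk y
    rw [← SeparationQuotient.map_mk_nhds, ← map_mul_left_nhds_one x]
    infer_instance
  · rw [← B.nhds_one_eq]
    exact (SeparationQuotient.isInducing_mk.nhds_eq_comap (1 : G)).symm

/-- A group with a quasi-invariant basis has its topology induced by continuous homomorphisms into
first countable Hausdorff groups. -/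
theorem HasQuasiInvariantBasis.exists_monoidHom {G : Type u} [Group G] [TopologicalSpace G]
    [IsTopologicalGroup G] (hqi : HasQuasiInvariantBasis G) {U : Set G} (hU : U ∈ 𝓝 1) :
    ∃ (M : Type u) (_ : Group M) (_ : TopologicalSpace M) (_ : IsTopologicalGroup M)
      (_ : T2Space M) (_ : FirstCountableTopology M) (g : G →* M),
      Continuous g ∧ ∃ V ∈ 𝓝 (1 : M), g ⁻¹' V ⊆ U := by
  obtain ⟨B, hBc, hUB, hBn⟩ := hqi.exists_groupFilterBasis hU
  obtain ⟨M, _, _, _, _, _, g, hg⟩ := B.exists_monoidHom hBc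
  refine ⟨M, inferInstance, inferInstance, inferInstance, inferInstance, inferInstance, g, ?_, ?_⟩
  · refine continuous_of_continuousAt_one g ?_
    rw [ContinuousAt, map_one, tendsto_iff_comap, hg]
    exact B.toFilterBasis.hasBasis.ge_iff.2 hBn
  · exact mem_comap.1 (hg ▸ B.toFilterBasis.mem_filter_of_mem hUB)

/-! ### Open homomorphisms and metrizable quotients. -/

theorem IsHereditarilyHComplete.isHComplete {G : Type u} [Group G] [TopologicalSpace G]
    (hG : IsHereditarilyHComplete G) : IsHComplete G :=
  (hG ⊤ isClosed_univ).of_surjective (⊤ : Subgroup G).subtype continuous_subtype_val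
    fun g => ⟨⟨g, trivial⟩, rfl⟩

instance Subgroup.firstCountableTopology {G : Type*} [Group G] [TopologicalSpace G]
    [FirstCountableTopology G] (S : Subgroup G) : FirstCountableTopology S :=
  Topology.IsInducing.subtypeVal.firstCountableTopology

/-- For a topologically countably generated `h`-complete group `S` and continuous homomorphisms `f`,
`g` into first countable groups, `f` maps the neighbourhoods of `1` induced by `g` to neighbourhoods
of `1` in the range of `f`. -/
theorem IsHComplete.image_preimage_mem_nhdsWithin {S H M : Type u} [Group S] [TopologicalSpace S]
    [TopologicalSpace.SeparableSpace S] [Group H] [TopologicalSpace H]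
    [IsTopologicalGroup H] [T2Space H] [FirstCountableTopology H] [Group M] [TopologicalSpace M]
    [IsTopologicalGroup M] [FirstCountableTopology M] (hS : IsHComplete S)
    (f : S →* H) (hf : Continuous f) (g : S →* M) (hg : Continuous g) {V : Set M} (hV : V ∈ 𝓝 1) :
    f '' (g ⁻¹' V) ∈ 𝓝[Set.range f] 1 := by
  have hfg : Continuous (f.prod g).rangeRestrict :=
    (hf.prodMk hg).subtype_mk _
  have hfr : Continuous f.rangeRestrict := hf.subtype_mk _
  have hfgs := (f.prod g).rangeRestrict_surjective
  have hA : IsHComplete (f.prod g).range := hS.of_surjective _ hfg hfgs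
  have : TopologicalSpace.SeparableSpace (f.prod g).range := hfgs.denseRange.separableSpace hfg
  have : TopologicalSpace.SeparableSpace f.range :=
    f.rangeRestrict_surjective.denseRange.separableSpace hfr
  have : SecondCountableTopology (f.prod g).range := secondCountableTopology_of_firstCountable
  have : SecondCountableTopology f.range := secondCountableTopology_of_firstCountable
  let p : (f.prod g).range →* f.range :=
    ((MonoidHom.fst H M).comp (f.prod g).range.subtype).codRestrict f.range (by
      rintro ⟨_, s, rfl⟩
      exact ⟨s, rfl⟩)
  have hp : Continuous p := (continuous_fst.comp continuous_subtype_val).subtype_mk _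
  have hps : Function.Surjective p := by
    rintro ⟨_, s, rfl⟩
    exact ⟨⟨_, s, rfl⟩, rfl⟩
  -- Openness of the projection from the range of `(f, g)` to that of `f` transfers the condition on
  -- `g` to `f`.
  have hop := hA.isOpenMap_of_secondCountable p hp hps
  have hW : (fun a : (f.prod g).range => a.1.2) ⁻¹' V ∈ 𝓝 1 :=
    (continuous_snd.comp continuous_subtype_val).continuousAt.preimage_mem_nhds hV
  have := hop.image_mem_nhds hW
  rw [map_one] at this
  have h2 := image_mem_map (m := ((↑) : f.range → H)) this
  rw [show (1 : f.range) = ⟨1, one_mem _⟩ from rfl] at h2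
  have h3 := (map_nhds_subtype_val (⟨1, one_mem _⟩ : f.range)).ge h2
  refine mem_of_superset h3 ?_
  rintro _ ⟨_, ⟨⟨_, s, rfl⟩, hs, rfl⟩, rfl⟩
  exact ⟨s, hs, rfl⟩

/-- Continuous homomorphisms of a hereditarily `h`-complete group with a quasi-invariant basis onto
first countable groups are open. -/
theorem IsHereditarilyHComplete.isOpenMap {G H : Type u} [Group G] [TopologicalSpace G]
    [IsTopologicalGroup G] [Group H] [TopologicalSpace H] [IsTopologicalGroup H]
    [T2Space H] [FirstCountableTopology H] (hG : IsHereditarilyHComplete G)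
    (hqi : HasQuasiInvariantBasis G) (f : G →* H) (hf : Continuous f)
    (hs : Function.Surjective f) : IsOpenMap f := by
  refine f.isOpenMap_of_image_mem_nhds_one fun U hU => ?_
  obtain ⟨M, _, _, _, _, _, g, hg, V, hV, hVU⟩ := hqi.exists_monoidHom hU
  refine mem_of_superset ?_ (image_mono hVU)
  by_contra hcon
  obtain ⟨h, hh, hhV⟩ := exists_seq_forall_of_frequently
    (show ∃ᶠ y in 𝓝 (1 : H), y ∉ f '' (g ⁻¹' V) from
      fun hev => hcon (hev.mono fun _ => not_not.1))
  choose x hx using fun n => hs (h n)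
  -- The closure of this countable subgroup is separable and `h`-complete, and its image under `f`
  -- contains every `h n`.
  let D : Subgroup G := (FreeGroup.lift x).range
  let S : Subgroup G := D.topologicalClosure
  have : Countable D := (FreeGroup.lift x).rangeRestrict_surjective.countable
  have hDS : DenseRange (inclusion (subset_closure (s := (D : Set G)))) :=
    (denseRange_inclusion_iff _).2 Subset.rfl
  have : TopologicalSpace.SeparableSpace S :=
    hDS.separableSpace (continuous_inclusion subset_closure)
  have hV' := (hG S D.isClosed_topologicalClosure).image_preimage_mem_nhdsWithin
    (f.comp S.subtype) (hf.comp continuous_subtype_val) (g.comp S.subtype)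
    (hg.comp continuous_subtype_val) hV
  have hhS : Tendsto h atTop (𝓝[Set.range (f.comp S.subtype)] 1) := by
    refine tendsto_nhdsWithin_iff.2 ⟨hh, Eventually.of_forall fun n => ?_⟩
    exact ⟨⟨x n, D.le_topologicalClosure ⟨FreeGroup.of n, FreeGroup.lift_apply_of⟩⟩, hx n⟩
  obtain ⟨n, s, hsV, hsn⟩ := (hhS.eventually hV').exists
  exact hhV n ⟨s, hsV, hsn⟩

/-- A homomorphism with kernel `f.ker` onto a first countable group makes `G ⧸ f.ker` a metrizable
quotient. -/
theorem IsHereditarilyHComplete.metrizableSpace_quotient_ker {G H : Type u} [Group G]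
    [TopologicalSpace G] [IsTopologicalGroup G] [Group H] [TopologicalSpace H]
    [IsTopologicalGroup H] [T2Space H] [FirstCountableTopology H]
    (hG : IsHereditarilyHComplete G) (hqi : HasQuasiInvariantBasis G) (f : G →* H)
    (hf : Continuous f) : TopologicalSpace.MetrizableSpace (G ⧸ f.ker) := by
  have hfr : Continuous f.rangeRestrict := hf.subtype_mk _
  have hop := hG.isOpenMap hqi f.rangeRestrict hfr f.rangeRestrict_surjective
  have hc : Continuous (QuotientGroup.rangeKerLift f) := continuous_quot_lift _ hfr
  have hopq : IsOpenMap (QuotientGroup.rangeKerLift f) := by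
    intro O hO
    have := hop _ (hO.preimage QuotientGroup.continuous_mk)
    convert this using 1
    ext y
    constructor
    · rintro ⟨z, hz, rfl⟩
      obtain ⟨x, rfl⟩ := QuotientGroup.mk_surjective z
      exact ⟨x, hz, rfl⟩
    · rintro ⟨x, hx, rfl⟩
      exact ⟨x, hx, rfl⟩
  have he := IsOpenEmbedding.of_continuous_injective_isOpenMap hc
    (QuotientGroup.rangeKerLift_injective f) hopq
  have := (hG.isHComplete.of_surjective f.rangeRestrict hfr
    f.rangeRestrict_surjective).isCompletelyMetrizableSpace
  exact he.isEmbedding.metrizableSpace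

/-! ### The projective limit. -/

namespace MetrizableKernel

variable {G : Type u} [Group G] [TopologicalSpace G]

instance metrizableSpace (N : MetrizableKernel G) :
    TopologicalSpace.MetrizableSpace (G ⧸ N.1) := N.2.2

variable [IsTopologicalGroup G]

/-- The kernel of a continuous homomorphism into a first countable group. -/
def ofKer (hG : IsHereditarilyHComplete G) (hqi : HasQuasiInvariantBasis G) {H : Type u} [Group H]
    [TopologicalSpace H] [IsTopologicalGroup H] [T2Space H] [FirstCountableTopology H]
    (f : G →* H) (hf : Continuous f) : MetrizableKernel G :=
  ⟨f.ker, inferInstance, hG.metrizableSpace_quotient_ker hqi f hf⟩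

theorem exists_eq_inf (hG : IsHereditarilyHComplete G) (hqi : HasQuasiInvariantBasis G)
    (N₁ N₂ : MetrizableKernel G) : ∃ N : MetrizableKernel G, N.1 = N₁.1 ⊓ N₂.1 := by
  refine ⟨ofKer hG hqi ((QuotientGroup.mk' N₁.1).prod (QuotientGroup.mk' N₂.1))
    (QuotientGroup.continuous_mk.prodMk QuotientGroup.continuous_mk), ?_⟩
  change MonoidHom.ker _ = _
  rw [MonoidHom.ker_prod, QuotientGroup.ker_mk', QuotientGroup.ker_mk']

theorem exists_le_finset (hG : IsHereditarilyHComplete G) (hqi : HasQuasiInvariantBasis G)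
    (I : Finset (MetrizableKernel G)) : ∃ N : MetrizableKernel G, ∀ M ∈ I, N.1 ≤ M.1 := by
  classical
  induction I using Finset.induction_on with
  | empty => exact ⟨ofKer hG hqi (1 : G →* PUnit.{u + 1}) continuous_const, by simp⟩
  | insert M I _ ih =>
    obtain ⟨N, hN⟩ := ih
    obtain ⟨K, hK⟩ := exists_eq_inf hG hqi M N
    refine ⟨K, (Finset.forall_mem_insert _ _ _).2 ⟨hK.trans_le inf_le_left, fun L hL => ?_⟩⟩
    exact (hK.trans_le inf_le_right).trans (hN L hL)

end MetrizableKernel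

section Limit

variable {G : Type u} [Group G] [TopologicalSpace G]

variable (G) in
/-- The canonical homomorphism from `G` to the projective limit of its metrizable quotients. -/
def toMetrizableLimit : G →* metrizableLimit G where
  toFun g := ⟨fun N => QuotientGroup.mk' N.1 g, fun _ _ _ => rfl⟩
  map_one' := rfl
  map_mul' _ _ := rfl

theorem continuous_toMetrizableLimit : Continuous (toMetrizableLimit G) :=
  (continuous_pi fun _ => QuotientGroup.continuous_mk).subtype_mk _

variable [IsTopologicalGroup G]

/-- A basic neighbourhood restricts finitely many coordinates; a kernel contained in all of theirs
reduces them to one, which lifts to `G`. -/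
theorem denseRange_toMetrizableLimit (hG : IsHereditarilyHComplete G)
    (hqi : HasQuasiInvariantBasis G) : DenseRange (toMetrizableLimit G) := by
  intro x
  refine mem_closure_iff_nhds.2 fun O hO => ?_
  obtain ⟨O', hO', hO'O⟩ := mem_nhds_subtype _ x O |>.1 hO
  rw [nhds_pi, Filter.mem_pi'] at hO'
  obtain ⟨I, t, ht, hI⟩ := hO'
  obtain ⟨N, hN⟩ := MetrizableKernel.exists_le_finset hG hqi I
  obtain ⟨y, hy⟩ := QuotientGroup.mk'_surjective N.1 (x.1 N)
  refine ⟨toMetrizableLimit G y, hO'O (hI fun M hM => ?_), y, rfl⟩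
  have h1 := (toMetrizableLimit G y).2 N M (hN M hM)
  have h2 := x.2 N M (hN M hM)
  have : (toMetrizableLimit G y).1 M = x.1 M := by
    rw [← h1, ← h2, ← hy]
    rfl
  rw [this]
  exact mem_of_mem_nhds (ht M)

theorem toMetrizableLimit_surjective (hG : IsHereditarilyHComplete G)
    (hqi : HasQuasiInvariantBasis G) : Function.Surjective (toMetrizableLimit G) := by
  rw [← range_eq_univ, ← (denseRange_toMetrizableLimit hG hqi).closure_range]
  exact (hG.isHComplete _ _ continuous_toMetrizableLimit).closure_eq.symm

theorem toMetrizableLimit_injective [T2Space G] (hG : IsHereditarilyHComplete G)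
    (hqi : HasQuasiInvariantBasis G) : Function.Injective (toMetrizableLimit G) := by
  refine (injective_iff_map_eq_one _).2 fun x hx => ?_
  by_contra hne
  obtain ⟨M, _, _, _, _, _, g, hg, V, hV, hVU⟩ :=
    hqi.exists_monoidHom (isOpen_compl_singleton.mem_nhds (Ne.symm hne) : {x}ᶜ ∈ 𝓝 1)
  have h1 : (x : G ⧸ g.ker) = 1 :=
    congrFun (congrArg Subtype.val hx) (MetrizableKernel.ofKer hG hqi g hg)
  have h2 : g x = 1 := (QuotientGroup.eq_one_iff x).1 h1
  exact hVU (show g x ∈ V from h2 ▸ mem_of_mem_nhds hV) rfl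

theorem isOpenMap_toMetrizableLimit (hG : IsHereditarilyHComplete G)
    (hqi : HasQuasiInvariantBasis G) : IsOpenMap (toMetrizableLimit G) := by
  refine (toMetrizableLimit G).isOpenMap_of_image_mem_nhds_one fun U hU => ?_
  obtain ⟨M, _, _, _, _, _, g, hg, V, hV, hVU⟩ := hqi.exists_monoidHom hU
  let N := MetrizableKernel.ofKer hG hqi g hg
  have hgV : g ⁻¹' V ∈ 𝓝 1 := hg.continuousAt.preimage_mem_nhds (by rwa [map_one])
  have hW : ((↑) : G → G ⧸ N.1) '' (g ⁻¹' V) ∈ 𝓝 (1 : G ⧸ N.1) :=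
    QuotientGroup.isOpenMap_coe.image_mem_nhds hgV
  have hN : Continuous fun x : metrizableLimit G => x.1 N :=
    (continuous_apply N).comp continuous_subtype_val
  -- One coordinate suffices: `g ⁻¹' V` is a union of cosets of `g.ker`, so membership in it is
  -- visible in `G ⧸ N.1`.
  refine mem_of_superset (hN.continuousAt.preimage_mem_nhds hW) ?_
  rintro x ⟨z, hz, hzx⟩
  obtain ⟨y, rfl⟩ := toMetrizableLimit_surjective hG hqi x
  have h1 : z⁻¹ * y ∈ g.ker := QuotientGroup.eq.1 hzx
  have h2 : g z = g y := by
    rwa [MonoidHom.mem_ker, map_mul, map_inv, inv_mul_eq_one] at h1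
  exact ⟨y, hVU (show g y ∈ V from h2 ▸ hz), rfl⟩

end Limit

theorem mainTheorem2 (G : Type u) [Group G] [TopologicalSpace G] [IsTopologicalGroup G] [T2Space G]
    (hG : IsHereditarilyHComplete G) (hqi : HasQuasiInvariantBasis G) :
    (∀ N₁ N₂ : MetrizableKernel G, ∃ N : MetrizableKernel G, N.1 = N₁.1 ⊓ N₂.1) ∧
      ∃ e : G ≃ₜ* metrizableLimit G,
        ∀ (g : G) (N : MetrizableKernel G), (e g).1 N = (QuotientGroup.mk g : G ⧸ N.1) := by
  refine ⟨MetrizableKernel.exists_eq_inf hG hqi, ?_⟩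
  let m := MulEquiv.ofBijective (toMetrizableLimit G)
    ⟨toMetrizableLimit_injective hG hqi, toMetrizableLimit_surjective hG hqi⟩
  refine ⟨{ m with
    continuous_toFun := continuous_toMetrizableLimit
    continuous_invFun := m.toEquiv.continuous_symm_iff.2 (isOpenMap_toMetrizableLimit hG hqi) },
    fun g N => rfl⟩
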